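/- Let $\sigma_a>0$ and $\epsilon>0$. For every $n\in\mathbb N$ let $\mathbf x=\mathbf x^{(n)}\in\mathbb R^n$ be arbitrary and let $\mathbf a$ and $\tilde{\mathbf x}$ be independent random vectors in $\mathbb R^n$ (depending on $n$, and defined on a probability space that may depend on $n$), where $\mathbf a\sim\mathcal N(\mathbf 0,\sigma_a^2\mathbf I)$ and $\tilde{\mathbf x}$ is uniformly distributed on the box $[\mathbf x-\epsilon\mathbf 1_n,\mathbf x+\epsilon\mathbf 1_n]$. Put $Y_i=\tilde x_ia_i-\mathbb E[a_i\tilde x_i]$ for $1\le i\le n$ and let $s_n\ge 0$ be given by $s_n^2=\operatorname{Var}\left(\sum_{i=1}^nY_i\right)$. Then all products $a_i\tilde x_i$ have finite absolute moments of every order, $s_n>0$ for $n\ge1$, and, as $n\to\infty$, $$\frac1{s_n}\sum_{i=1}^n\left(\tilde x_ia_i-\mathbb E[a_i\tilde x_i]\right)\ \xrightarrow{\,d\,}\ \mathcal N(0,1).$$ Moreover, for every $\delta>0$, the Lyapunov condition $\lim_{n\to\infty}s_n^{-(2+\delta)}\sum_{i=1}^n\mathbb E|Y_i|^{2+\delta}=0$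 holds if and only if $\max_{1\le i\le n}|x^{(n)}_i|/s_n\to0$ as $n\to\infty$. -/

import Mathlib

open MeasureTheory ProbabilityTheory Filter Topology

noncomputable section

/-- The centred products `Y_i = x̃_i a_i - E[a_i x̃_i]`, `i = 1, …, n`. -/
def centeredProduct {n : ℕ} {Ω : Type*} [MeasurableSpace Ω] (P : Measure Ω)
    (a : Ω → EuclideanSpace ℝ (Fin n)) (xt : Ω → Fin n → ℝ) (i : Fin n) (ω : Ω) : ℝ :=
  xt ω i * a ω i - ∫ ω', a ω' i * xt ω' i ∂P

/-- `s_n`, the standard deviation of the sum of the centred products: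
`s_n ^ 2 = Var (∑ i, (x̃_i a_i - E[a_i x̃_i]))`. -/
def sumStd {n : ℕ} {Ω : Type*} [MeasurableSpace Ω] (P : Measure Ω)
    (a : Ω → EuclideanSpace ℝ (Fin n)) (xt : Ω → Fin n → ℝ) : ℝ :=
  Real.sqrt (variance (fun ω => ∑ i, centeredProduct P a xt i ω) P)

/-- Lyapunov's condition of order `δ` for the rows of centred products:
`s_n ^ (-(2 + δ)) * ∑_{i ≤ n} E |Y_i| ^ (2 + δ) → 0` as `n → ∞`. -/
def LyapunovCondition {Ω : ℕ → Type*} [∀ n, MeasurableSpace (Ω n)] (P : ∀ n, Measure (Ω n))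
    (a : ∀ n, Ω n → EuclideanSpace ℝ (Fin n)) (xt : ∀ n, Ω n → Fin n → ℝ) (δ : ℝ) : Prop :=
  Tendsto (fun n : ℕ => (1 / sumStd (P n) (a n) (xt n) ^ (2 + δ)) *
    ∑ i, ∫ ω, |centeredProduct (P n) (a n) (xt n) i ω| ^ (2 + δ) ∂(P n)) atTop (𝓝 0)

end

/-! Write `X` for the uniform vector and S = ∑ (x_i² + ε²/3) = E ∑ X_i², so that s_n² = σ² S. Given
`X`, the sum ∑ a_i X_i is exactly centred Gaussian with variance σ² ∑ X_i², so the characteristic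
function of the normalized sum is E exp(-t² ∑ X_i² / (2S)) (`charFun_map_sum_mul_of_isotropic`). The
limit theorem thus reduces to a law of large numbers for ∑ X_i² / S. As X_i stays within ε of x_i,
Var(X_i²) is only quadratic in x_i, so Var(∑ X_i²) ≤ 8ε² S. With S ≥ nε²/3 this gives a relative L¹
error of at most √(24/n), whatever the centres are.

For Lyapunov's condition, E|Y_i|^p is a positive Gaussian constant times E|X_i|^p. Jensen on the
largest coordinate bounds the ratio below by a multiple of (‖x‖/s_n)^(2+δ); pulling |X_i|^δ ≤
(‖x‖+ε)^δ out of the moments bounds it above by a multiple of ((‖x‖+ε)/s_n)^δ, and ε/s_n → 0. -/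

lemma cond_volume_pi_Icc {n : ℕ} (l u : Fin n → ℝ) :
    (ProbabilityTheory.cond volume (Set.Icc l u) : Measure (Fin n → ℝ)) =
      Measure.pi fun i => ProbabilityTheory.cond volume (Set.Icc (l i) (u i)) := by
  by_cases h : ∀ i, l i < u i
  · have hp : ∀ i, volume (Set.Icc (l i) (u i)) ≠ 0 := fun i => by
      simpa using h i
    have (i : Fin n) : IsProbabilityMeasure (ProbabilityTheory.cond volume (Set.Icc (l i) (u i))) :=
      cond_isProbabilityMeasure_of_finite (hp i) (by simp)
    refine (Measure.pi_eq fun s hs => ?_).symm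
    rw [← Set.pi_univ_Icc, cond_apply (MeasurableSet.univ_pi fun i => measurableSet_Icc),
      ← Set.pi_inter_distrib, volume_pi_pi, volume_pi_pi,
      ENNReal.prod_inv_distrib, ← Finset.prod_mul_distrib]
    · exact Finset.prod_congr rfl fun i _ => (cond_apply measurableSet_Icc _ _).symm
    · intro i _ j _ _
      exact Or.inl (hp i)
  -- Degenerate box: conditioning on a null set gives the zero measure, and one zero factor
  -- annihilates the product.
  · push Not at h
    obtain ⟨i, hi⟩ := h
    have h1 : volume (Set.Icc (l i) (u i)) = 0 := by simp [hi]
    have h2 : volume (Set.Icc l u) = 0 := by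
      rw [← Set.pi_univ_Icc, volume_pi_pi]
      exact Finset.prod_eq_zero (Finset.mem_univ i) h1
    rw [cond_eq_zero_of_meas_eq_zero h2, eq_comm, ← Measure.measure_univ_eq_zero,
      Measure.pi_univ]
    exact Finset.prod_eq_zero (Finset.mem_univ i) (by simp [cond_eq_zero_of_meas_eq_zero h1])

/-! ### Moments and concentration for a uniform vector on a box. -/

section UniformBox

variable {n : ℕ} {Ω : Type*} [MeasurableSpace Ω] {P : Measure Ω}
  {x : Fin n → ℝ} {ε : ℝ} {X : Ω → Fin n → ℝ}

lemma isProbabilityMeasure_cond_Icc (hε : 0 < ε) (c : ℝ) :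
    IsProbabilityMeasure (ProbabilityTheory.cond volume (Set.Icc (c - ε) (c + ε)) : Measure ℝ) :=
  cond_isProbabilityMeasure_of_finite (by simp; linarith) (by simp)

lemma integral_cond_Icc (hε : 0 < ε) (c : ℝ) (f : ℝ → ℝ) :
    ∫ y, f y ∂(ProbabilityTheory.cond volume (Set.Icc (c - ε) (c + ε)) : Measure ℝ) =
      (2 * ε)⁻¹ * ∫ y in (c - ε)..(c + ε), f y := by
  rw [ProbabilityTheory.cond, integral_smul_measure, integral_Icc_eq_integral_Ioc,
    intervalIntegral.integral_of_le (by linarith), Real.volume_Icc, smul_eq_mul,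
    ENNReal.toReal_inv, ENNReal.toReal_ofReal (by linarith)]
  ring_nf

/-- The hypothesis fixes only the law. Pushing forward along a map that is not a.e. measurable gives
0, which is excluded because the box has positive finite volume. -/
lemma aemeasurable_of_isUniform_box (hε : 0 < ε)
    (hX : pdf.IsUniform X (Set.Icc (fun i => x i - ε) (fun i => x i + ε)) P volume) :
    AEMeasurable X P := by
  refine hX.aemeasurable ?_ ?_
  · rw [← Set.pi_univ_Icc, volume_pi_pi]
    refine Finset.prod_ne_zero_iff.2 fun i _ => ?_
    simp; linarith
  · exact isCompact_Icc.measure_lt_top.ne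

lemma map_eq_pi_of_isUniform_box
    (hX : pdf.IsUniform X (Set.Icc (fun i => x i - ε) (fun i => x i + ε)) P volume) :
    P.map X = Measure.pi fun i => ProbabilityTheory.cond volume (Set.Icc (x i - ε) (x i + ε)) :=
  hX.trans (cond_volume_pi_Icc _ _)

lemma map_apply_of_isUniform_box (hε : 0 < ε)
    (hX : pdf.IsUniform X (Set.Icc (fun i => x i - ε) (fun i => x i + ε)) P volume) (i : Fin n) :
    P.map (fun ω => X ω i) = ProbabilityTheory.cond volume (Set.Icc (x i - ε) (x i + ε)) := by
  have := fun i => isProbabilityMeasure_cond_Icc hε (x i)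
  rw [← (measurePreserving_eval (fun i => ProbabilityTheory.cond volume (Set.Icc (x i - ε) (x i + ε))) i).map_eq,
    ← map_eq_pi_of_isUniform_box hX,
    AEMeasurable.map_map_of_aemeasurable (measurable_pi_apply i).aemeasurable (aemeasurable_of_isUniform_box hε hX)]
  rfl

lemma aemeasurable_apply_of_isUniform_box (hε : 0 < ε)
    (hX : pdf.IsUniform X (Set.Icc (fun i => x i - ε) (fun i => x i + ε)) P volume) (i : Fin n) :
    AEMeasurable (fun ω => X ω i) P :=
  (measurable_pi_apply i).comp_aemeasurable (aemeasurable_of_isUniform_box hε hX)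

lemma iIndepFun_of_isUniform_box [IsProbabilityMeasure P] (hε : 0 < ε)
    (hX : pdf.IsUniform X (Set.Icc (fun i => x i - ε) (fun i => x i + ε)) P volume) :
    iIndepFun (fun i ω => X ω i) P := by
  rw [iIndepFun_iff_map_fun_eq_pi_map (aemeasurable_apply_of_isUniform_box hε hX)]
  simp_rw [map_apply_of_isUniform_box hε hX]
  exact map_eq_pi_of_isUniform_box hX

lemma ae_abs_sub_le_of_isUniform_box (hε : 0 < ε)
    (hX : pdf.IsUniform X (Set.Icc (fun i => x i - ε) (fun i => x i + ε)) P volume) (i : Fin n) :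
    ∀ᵐ ω ∂P, |X ω i - x i| ≤ ε := by
  refine ae_of_ae_map (p := fun y => |y - x i| ≤ ε)
    (aemeasurable_apply_of_isUniform_box hε hX i) ?_
  rw [map_apply_of_isUniform_box hε hX]
  filter_upwards [ae_cond_mem (μ := (volume : Measure ℝ))
    (measurableSet_Icc (a := x i - ε) (b := x i + ε))] with y hy
  rw [abs_le]
  constructor <;> linarith [hy.1, hy.2]

lemma ae_abs_le_of_isUniform_box (hε : 0 < ε)
    (hX : pdf.IsUniform X (Set.Icc (fun i => x i - ε) (fun i => x i + ε)) P volume) (i : Fin n) :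
    ∀ᵐ ω ∂P, |X ω i| ≤ |x i| + ε := by
  filter_upwards [ae_abs_sub_le_of_isUniform_box hε hX i] with ω hω
  linarith [abs_sub_abs_le_abs_sub (X ω i) (x i)]

lemma memLp_top_of_isUniform_box (hε : 0 < ε)
    (hX : pdf.IsUniform X (Set.Icc (fun i => x i - ε) (fun i => x i + ε)) P volume) (i : Fin n) :
    MemLp (fun ω => X ω i) ⊤ P :=
  memLp_top_of_bound (aemeasurable_apply_of_isUniform_box hε hX i).aestronglyMeasurable
    (|x i| + ε) (ae_abs_le_of_isUniform_box hε hX i)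

lemma integral_apply_of_isUniform_box (hε : 0 < ε)
    (hX : pdf.IsUniform X (Set.Icc (fun i => x i - ε) (fun i => x i + ε)) P volume) (i : Fin n) :
    ∫ ω, X ω i ∂P = x i := by
  rw [← integral_map (f := fun y : ℝ => y) (aemeasurable_apply_of_isUniform_box hε hX i)
    (by fun_prop), map_apply_of_isUniform_box hε hX, integral_cond_Icc hε, integral_id]
  field_simp
  ring

lemma integral_sq_apply_of_isUniform_box (hε : 0 < ε)
    (hX : pdf.IsUniform X (Set.Icc (fun i => x i - ε) (fun i => x i + ε)) P volume) (i : Fin n) :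
    ∫ ω, X ω i ^ 2 ∂P = x i ^ 2 + ε ^ 2 / 3 := by
  rw [← integral_map (f := fun y : ℝ => y ^ 2) (aemeasurable_apply_of_isUniform_box hε hX i)
    (by fun_prop), map_apply_of_isUniform_box hε hX, integral_cond_Icc hε, integral_pow]
  field_simp
  ring

lemma memLp_sq_apply_of_isUniform_box [IsProbabilityMeasure P] (hε : 0 < ε)
    (hX : pdf.IsUniform X (Set.Icc (fun i => x i - ε) (fun i => x i + ε)) P volume) (i : Fin n) :
    MemLp (fun ω => X ω i ^ 2) 2 P := by
  refine MemLp.of_bound ((aemeasurable_apply_of_isUniform_box hε hX i).pow_const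
    2).aestronglyMeasurable ((|x i| + ε) ^ 2) ?_
  filter_upwards [ae_abs_le_of_isUniform_box hε hX i] with ω hω
  rw [norm_pow, Real.norm_eq_abs]
  gcongr

/-- Centring at x_i² instead of the mean, X_i² - x_i² = u(2x_i + u) with |u| ≤ ε. The bound is a
multiple of E X_i², which makes the variance of the sum linear in its mean. -/
lemma variance_sq_apply_le_of_isUniform_box [IsProbabilityMeasure P] (hε : 0 < ε)
    (hX : pdf.IsUniform X (Set.Icc (fun i => x i - ε) (fun i => x i + ε)) P volume) (i : Fin n) :
    variance (fun ω => X ω i ^ 2) P ≤ 8 * ε ^ 2 * (x i ^ 2 + ε ^ 2 / 3) := by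
  have hm := memLp_sq_apply_of_isUniform_box hε hX i
  rw [← variance_sub_const hm.aestronglyMeasurable (x i ^ 2)]
  refine (variance_le_expectation_sq (hm.aestronglyMeasurable.sub aestronglyMeasurable_const)).trans ?_
  have hb : ∀ᵐ ω ∂P, (X ω i ^ 2 - x i ^ 2) ^ 2 ≤ 8 * ε ^ 2 * (x i ^ 2 + ε ^ 2 / 3) := by
    filter_upwards [ae_abs_sub_le_of_isUniform_box hε hX i] with ω hω
    set u := X ω i - x i with hu
    have h1 : u ^ 2 ≤ ε ^ 2 := sq_le_sq' (abs_le.1 hω).1 (abs_le.1 hω).2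
    have h2 : X ω i = x i + u := by rw [hu]; ring
    have h3 : (X ω i ^ 2 - x i ^ 2) ^ 2 ≤ u ^ 2 * (8 * x i ^ 2 + 2 * u ^ 2) := by
      -- (2x + u)² + (2x - u)² = 8x² + 2u².
      rw [h2]; nlinarith [mul_nonneg (sq_nonneg u) (sq_nonneg (2 * x i - u))]
    refine h3.trans ((mul_le_mul h1 (add_le_add_right (mul_le_mul_of_nonneg_left h1 zero_le_two) _)
      (by positivity) (by positivity)).trans ?_)
    nlinarith [sq_nonneg (ε ^ 2)]
  refine (integral_mono_ae (hm.sub (memLp_const _)).integrable_sq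
    (integrable_const (8 * ε ^ 2 * (x i ^ 2 + ε ^ 2 / 3))) hb).trans ?_
  simp

lemma integral_sum_sq_of_isUniform_box [IsProbabilityMeasure P] (hε : 0 < ε)
    (hX : pdf.IsUniform X (Set.Icc (fun i => x i - ε) (fun i => x i + ε)) P volume) :
    ∫ ω, ∑ i, X ω i ^ 2 ∂P = ∑ i, (x i ^ 2 + ε ^ 2 / 3) := by
  rw [integral_finsetSum _ fun i _ =>
    (memLp_sq_apply_of_isUniform_box hε hX i).integrable one_le_two]
  simp_rw [integral_sq_apply_of_isUniform_box hε hX]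

lemma variance_sum_sq_le_of_isUniform_box [IsProbabilityMeasure P] (hε : 0 < ε)
    (hX : pdf.IsUniform X (Set.Icc (fun i => x i - ε) (fun i => x i + ε)) P volume) :
    variance (fun ω => ∑ i, X ω i ^ 2) P ≤ 8 * ε ^ 2 * ∑ i, (x i ^ 2 + ε ^ 2 / 3) := by
  have h := IndepFun.variance_sum (μ := P) (s := Finset.univ) (X := fun i ω => X ω i ^ 2)
    (fun i _ => memLp_sq_apply_of_isUniform_box hε hX i) fun i _ j _ hij =>
      ((iIndepFun_of_isUniform_box hε hX).indepFun hij).comp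
        (φ := fun y : ℝ => y ^ 2) (ψ := fun y : ℝ => y ^ 2) (by fun_prop) (by fun_prop)
  have he : (fun ω => ∑ i, X ω i ^ 2) = ∑ i, fun ω => X ω i ^ 2 := by ext; simp
  rw [he, h, Finset.mul_sum]
  exact Finset.sum_le_sum fun i _ => variance_sq_apply_le_of_isUniform_box hε hX i

lemma sq_integral_abs_le_integral_sq {Ω : Type*} [MeasurableSpace Ω] {P : Measure Ω}
    [IsProbabilityMeasure P] {f : Ω → ℝ} (hf : MemLp f 2 P) :
    (∫ ω, |f ω| ∂P) ^ 2 ≤ ∫ ω, f ω ^ 2 ∂P := by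
  have h := variance_nonneg |f| P
  rw [variance_eq_sub hf.abs] at h
  simpa using h

/-- The sum of squares of a uniform vector on a box concentrates about its mean in `L¹`. -/
lemma sq_integral_abs_sum_sq_sub_le_of_isUniform_box [IsProbabilityMeasure P] (hε : 0 < ε)
    (hX : pdf.IsUniform X (Set.Icc (fun i => x i - ε) (fun i => x i + ε)) P volume) :
    (∫ ω, |∑ i, X ω i ^ 2 - ∑ i, (x i ^ 2 + ε ^ 2 / 3)| ∂P) ^ 2 ≤
      8 * ε ^ 2 * ∑ i, (x i ^ 2 + ε ^ 2 / 3) := by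
  have hm : MemLp (fun ω => ∑ i, X ω i ^ 2) 2 P :=
    memLp_finsetSum _ fun i _ => memLp_sq_apply_of_isUniform_box hε hX i
  refine (sq_integral_abs_le_integral_sq (hm.sub (memLp_const _))).trans ?_
  refine le_trans (le_of_eq ?_) (variance_sum_sq_le_of_isUniform_box hε hX)
  rw [variance_eq_integral hm.aemeasurable, integral_sum_sq_of_isUniform_box hε hX]
  rfl

lemma integrable_abs_rpow_apply_of_isUniform_box [IsProbabilityMeasure P] (hε : 0 < ε)
    (hX : pdf.IsUniform X (Set.Icc (fun i => x i - ε) (fun i => x i + ε)) P volume) (i : Fin n)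
    {p : ℝ} (hp : 0 ≤ p) : Integrable (fun ω => |X ω i| ^ p) P := by
  refine Integrable.of_bound ((aemeasurable_apply_of_isUniform_box hε hX i).abs.pow_const
    p).aestronglyMeasurable ((|x i| + ε) ^ p) ?_
  filter_upwards [ae_abs_le_of_isUniform_box hε hX i] with ω hω
  rw [Real.norm_eq_abs, abs_of_nonneg (by positivity)]
  gcongr

/-- Jensen twice, starting from E X_i = x_i: for the absolute value, then for the convex power. -/
lemma abs_rpow_le_integral_of_isUniform_box [IsProbabilityMeasure P] (hε : 0 < ε)
    (hX : pdf.IsUniform X (Set.Icc (fun i => x i - ε) (fun i => x i + ε)) P volume) (i : Fin n)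
    {p : ℝ} (hp : 1 ≤ p) : |x i| ^ p ≤ ∫ ω, |X ω i| ^ p ∂P := by
  have hint : Integrable (fun ω => |X ω i|) P :=
    ((memLp_top_of_isUniform_box hε hX i).integrable le_top).abs
  calc |x i| ^ p ≤ (∫ ω, |X ω i| ∂P) ^ p := by
        rw [← integral_apply_of_isUniform_box hε hX i]
        gcongr
        exact abs_integral_le_integral_abs
    _ ≤ _ := (convexOn_rpow hp).map_integral_le
        (Real.continuous_rpow_const (by linarith)).continuousOn isClosed_Ici
        (.of_forall fun ω => Set.mem_Ici.2 (abs_nonneg _)) hint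
        (integrable_abs_rpow_apply_of_isUniform_box hε hX i (by linarith))

/-- Bounding only the δ extra powers uniformly leaves second moments, whose sum is s_n²/σ². -/
lemma integral_abs_rpow_le_of_isUniform_box [IsProbabilityMeasure P] (hε : 0 < ε)
    (hX : pdf.IsUniform X (Set.Icc (fun i => x i - ε) (fun i => x i + ε)) P volume) (i : Fin n)
    {δ : ℝ} (hδ : 0 ≤ δ) :
    ∫ ω, |X ω i| ^ (2 + δ) ∂P ≤ (‖x‖ + ε) ^ δ * (x i ^ 2 + ε ^ 2 / 3) := by
  rw [← integral_sq_apply_of_isUniform_box hε hX i, ← integral_const_mul]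
  refine integral_mono_ae (integrable_abs_rpow_apply_of_isUniform_box hε hX i (by linarith))
    (((memLp_sq_apply_of_isUniform_box hε hX i).integrable one_le_two).const_mul _) ?_
  filter_upwards [ae_abs_le_of_isUniform_box hε hX i] with ω hω
  rw [add_comm, Real.rpow_add_of_nonneg (abs_nonneg _) hδ zero_le_two, Real.rpow_two, sq_abs]
  have := norm_le_pi_norm x i
  rw [Real.norm_eq_abs] at this
  gcongr
  linarith

end UniformBox

/-! ### Coordinates of an isotropic Gaussian vector. -/

section IsotropicGaussian

variable {n : ℕ} {Ω : Type*} [MeasurableSpace Ω] {P : Measure Ω} {σ : ℝ}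
  {a : Ω → EuclideanSpace ℝ (Fin n)}

lemma posSemidef_sq_smul_one (n : ℕ) (σ : ℝ) :
    (σ ^ 2 • (1 : Matrix (Fin n) (Fin n) ℝ)).PosSemidef :=
  Matrix.PosSemidef.one.smul (sq_nonneg σ)

lemma hasLaw_apply_of_isotropic
    (ha : HasLaw a (multivariateGaussian 0 (σ ^ 2 • (1 : Matrix (Fin n) (Fin n) ℝ))) P)
    (i : Fin n) : HasLaw (fun ω => a ω i) (gaussianReal 0 (σ ^ 2).toNNReal) P := by
  have h := measurePreserving_eval_multivariateGaussian (μ := 0) (posSemidef_sq_smul_one n σ)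
    (i := i)
  simp only [Matrix.smul_apply, Matrix.one_apply_eq, smul_eq_mul, mul_one] at h
  exact HasLaw.comp ⟨h.measurable.aemeasurable, h.map_eq⟩ ha

lemma memLp_apply_of_isotropic
    (ha : HasLaw a (multivariateGaussian 0 (σ ^ 2 • (1 : Matrix (Fin n) (Fin n) ℝ))) P)
    (i : Fin n) (p : NNReal) : MemLp (fun ω => a ω i) p P := by
  have h := hasLaw_apply_of_isotropic ha i
  have := memLp_id_gaussianReal (μ := 0) (v := (σ ^ 2).toNNReal) p
  rw [← h.map_eq] at this
  exact this.comp_of_map h.aemeasurable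

lemma integral_apply_of_isotropic
    (ha : HasLaw a (multivariateGaussian 0 (σ ^ 2 • (1 : Matrix (Fin n) (Fin n) ℝ))) P)
    (i : Fin n) : ∫ ω, a ω i ∂P = 0 := by
  rw [(hasLaw_apply_of_isotropic ha i).integral_eq, integral_id_gaussianReal]

lemma integral_apply_mul_apply_of_isotropic [IsProbabilityMeasure P]
    (ha : HasLaw a (multivariateGaussian 0 (σ ^ 2 • (1 : Matrix (Fin n) (Fin n) ℝ))) P)
    (i j : Fin n) : ∫ ω, a ω i * a ω j ∂P = if i = j then σ ^ 2 else 0 := by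
  have h := covariance_eval_multivariateGaussian (μ := 0) (posSemidef_sq_smul_one n σ) i j
  rw [← ha.map_eq, covariance_map_fun (by fun_prop) (by fun_prop) ha.aemeasurable,
    covariance_eq_sub (memLp_apply_of_isotropic ha i 2) (memLp_apply_of_isotropic ha j 2)] at h
  simpa [integral_apply_of_isotropic ha, Matrix.one_apply] using h

/-- The absolute moment of order `p` of the centred Gaussian law of standard deviation `σ`. -/
noncomputable def gaussianAbsMoment (σ p : ℝ) : ℝ :=
  ∫ y, |y| ^ p ∂(gaussianReal 0 (σ ^ 2).toNNReal)

lemma integral_abs_rpow_apply_of_isotropic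
    (ha : HasLaw a (multivariateGaussian 0 (σ ^ 2 • (1 : Matrix (Fin n) (Fin n) ℝ))) P)
    (i : Fin n) (p : ℝ) : ∫ ω, |a ω i| ^ p ∂P = gaussianAbsMoment σ p := by
  have h := hasLaw_apply_of_isotropic ha i
  rw [gaussianAbsMoment, ← h.map_eq, integral_map h.aemeasurable]
  exact (measurable_id.abs.pow_const p).aestronglyMeasurable

/-- A nondegenerate Gaussian has no atom at 0, the only zero of the integrand. Positivity allows
division by this constant when Lyapunov's condition is assumed. -/
lemma gaussianAbsMoment_pos (hσ : 0 < σ) {p : ℝ} (hp : 0 < p) : 0 < gaussianAbsMoment σ p := by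
  have hv : (σ ^ 2).toNNReal ≠ 0 := by simpa using hσ.ne'
  have := nullSingletonClass_gaussianReal (μ := 0) hv
  have hint := (memLp_id_gaussianReal (μ := 0) (v := (σ ^ 2).toNNReal) p.toNNReal).integrable_norm_rpow'
  simp only [ENNReal.coe_toReal, Real.coe_toNNReal p hp.le, id, Real.norm_eq_abs] at hint
  refine (integral_pos_iff_support_of_nonneg (fun y => by positivity) hint).2 ?_
  have hs : Function.support (fun y : ℝ => |y| ^ p) = {0}ᶜ := by
    ext y; simp [Real.rpow_eq_zero (abs_nonneg y) hp.ne']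
  rw [hs, measure_compl (measurableSet_singleton 0) (by simp)]
  simp

end IsotropicGaussian

/-! ### The products: covariances, moments and the characteristic function of their sum. -/

section Products

variable {n : ℕ} {Ω : Type*} [MeasurableSpace Ω] {P : Measure Ω}
  {σ ε : ℝ} {x : Fin n → ℝ} {a : Ω → EuclideanSpace ℝ (Fin n)} {X : Ω → Fin n → ℝ}

lemma memLp_mul_of_isotropic_of_isUniform_box (hε : 0 < ε)
    (ha : HasLaw a (multivariateGaussian 0 (σ ^ 2 • (1 : Matrix (Fin n) (Fin n) ℝ))) P)
    (hX : pdf.IsUniform X (Set.Icc (fun i => x i - ε) (fun i => x i + ε)) P volume)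
    (i : Fin n) (p : NNReal) : MemLp (fun ω => a ω i * X ω i) p P :=
  (memLp_top_of_isUniform_box hε hX i).mul (memLp_apply_of_isotropic ha i p)

lemma integral_mul_eq_zero_of_isotropic (hε : 0 < ε)
    (ha : HasLaw a (multivariateGaussian 0 (σ ^ 2 • (1 : Matrix (Fin n) (Fin n) ℝ))) P)
    (hX : pdf.IsUniform X (Set.Icc (fun i => x i - ε) (fun i => x i + ε)) P volume)
    (hind : IndepFun a X P) (i : Fin n) : ∫ ω, a ω i * X ω i ∂P = 0 := by
  have h : IndepFun (fun ω => a ω i) (fun ω => X ω i) P :=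
    hind.comp (φ := fun v : EuclideanSpace ℝ (Fin n) => v i) (ψ := fun v : Fin n → ℝ => v i)
      (by fun_prop) (by fun_prop)
  rw [h.integral_fun_mul_eq_mul_integral
    (hasLaw_apply_of_isotropic ha i).aemeasurable.aestronglyMeasurable
    (aemeasurable_apply_of_isUniform_box hε hX i).aestronglyMeasurable,
    integral_apply_of_isotropic ha, zero_mul]

lemma centeredProduct_eq (hε : 0 < ε)
    (ha : HasLaw a (multivariateGaussian 0 (σ ^ 2 • (1 : Matrix (Fin n) (Fin n) ℝ))) P)
    (hX : pdf.IsUniform X (Set.Icc (fun i => x i - ε) (fun i => x i + ε)) P volume)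
    (hind : IndepFun a X P) : centeredProduct P a X = fun i ω => a ω i * X ω i := by
  ext i ω
  rw [centeredProduct, integral_mul_eq_zero_of_isotropic hε ha hX hind, sub_zero, mul_comm]

lemma covariance_mul_mul_of_isotropic [IsProbabilityMeasure P] (hε : 0 < ε)
    (ha : HasLaw a (multivariateGaussian 0 (σ ^ 2 • (1 : Matrix (Fin n) (Fin n) ℝ))) P)
    (hX : pdf.IsUniform X (Set.Icc (fun i => x i - ε) (fun i => x i + ε)) P volume)
    (hind : IndepFun a X P) (i j : Fin n) :
    covariance (fun ω => a ω i * X ω i) (fun ω => a ω j * X ω j) P =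
      if i = j then σ ^ 2 * (x i ^ 2 + ε ^ 2 / 3) else 0 := by
  have hm := fun i => memLp_mul_of_isotropic_of_isUniform_box hε ha hX i 2
  have hai := fun i => (hasLaw_apply_of_isotropic ha i).aemeasurable
  have hXi := aemeasurable_apply_of_isUniform_box hε hX
  rw [covariance_eq_sub (hm i) (hm j), integral_mul_eq_zero_of_isotropic hε ha hX hind, zero_mul,
    sub_zero]
  have h : IndepFun (fun ω => a ω i * a ω j) (fun ω => X ω i * X ω j) P :=
    hind.comp (φ := fun v : EuclideanSpace ℝ (Fin n) => v i * v j)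
      (ψ := fun v : Fin n → ℝ => v i * v j) (by fun_prop) (by fun_prop)
  have he : ((fun ω => a ω i * X ω i) * fun ω => a ω j * X ω j) =
      fun ω => (a ω i * a ω j) * (X ω i * X ω j) := by
    ext ω; simp only [Pi.mul_apply]; ring
  rw [he, h.integral_fun_mul_eq_mul_integral ((hai i).mul (hai j)).aestronglyMeasurable
    ((hXi i).mul (hXi j)).aestronglyMeasurable, integral_apply_mul_apply_of_isotropic ha]
  split_ifs with hij
  · subst hij
    simp_rw [← pow_two, integral_sq_apply_of_isUniform_box hε hX]
  · rw [zero_mul]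

lemma sumStd_eq [IsProbabilityMeasure P] (hε : 0 < ε)
    (ha : HasLaw a (multivariateGaussian 0 (σ ^ 2 • (1 : Matrix (Fin n) (Fin n) ℝ))) P)
    (hX : pdf.IsUniform X (Set.Icc (fun i => x i - ε) (fun i => x i + ε)) P volume)
    (hind : IndepFun a X P) :
    sumStd P a X = √(σ ^ 2 * ∑ i, (x i ^ 2 + ε ^ 2 / 3)) := by
  rw [sumStd, centeredProduct_eq hε ha hX hind,
    variance_fun_sum fun i => memLp_mul_of_isotropic_of_isUniform_box hε ha hX i 2]
  simp_rw [covariance_mul_mul_of_isotropic hε ha hX hind]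
  simp [Finset.mul_sum]

lemma integral_abs_rpow_mul_of_isotropic (hε : 0 < ε)
    (ha : HasLaw a (multivariateGaussian 0 (σ ^ 2 • (1 : Matrix (Fin n) (Fin n) ℝ))) P)
    (hX : pdf.IsUniform X (Set.Icc (fun i => x i - ε) (fun i => x i + ε)) P volume)
    (hind : IndepFun a X P) (i : Fin n) (p : ℝ) :
    ∫ ω, |a ω i * X ω i| ^ p ∂P = gaussianAbsMoment σ p * ∫ ω, |X ω i| ^ p ∂P := by
  have h : IndepFun (fun ω => |a ω i| ^ p) (fun ω => |X ω i| ^ p) P :=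
    hind.comp (φ := fun v : EuclideanSpace ℝ (Fin n) => |v i| ^ p)
      (ψ := fun v : Fin n → ℝ => |v i| ^ p) (by fun_prop) (by fun_prop)
  rw [← integral_abs_rpow_apply_of_isotropic ha i p, ← h.integral_fun_mul_eq_mul_integral
    ((hasLaw_apply_of_isotropic ha i).aemeasurable.abs.pow_const p).aestronglyMeasurable
    ((aemeasurable_apply_of_isUniform_box hε hX i).abs.pow_const p).aestronglyMeasurable]
  refine integral_congr_ae (.of_forall fun ω => ?_)
  simp only [abs_mul, Real.mul_rpow (abs_nonneg _) (abs_nonneg _)]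

/-- Conditionally on `X`, the sum `∑ i, a i * X i` is centred Gaussian of variance
`σ ^ 2 * ∑ i, X i ^ 2`. -/
lemma charFun_map_sum_mul_of_isotropic [IsProbabilityMeasure P] (hXm : AEMeasurable X P)
    (ha : HasLaw a (multivariateGaussian 0 (σ ^ 2 • (1 : Matrix (Fin n) (Fin n) ℝ))) P)
    (hind : IndepFun a X P) (c t : ℝ) :
    charFun (P.map fun ω => c * ∑ i, a ω i * X ω i) t =
      ((∫ ω, Real.exp (-((t * c) ^ 2 * σ ^ 2 / 2 * ∑ i, X ω i ^ 2)) ∂P : ℝ) : ℂ) := by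
  have ham := ha.aemeasurable
  have hjoint := (indepFun_iff_map_prod_eq_prod_map_map ham hXm).1 hind
  have : IsProbabilityMeasure (P.map X) := Measure.isProbabilityMeasure_map hXm
  have : IsProbabilityMeasure (P.map a) := Measure.isProbabilityMeasure_map ham
  let F : EuclideanSpace ℝ (Fin n) × (Fin n → ℝ) → ℂ := fun z =>
    Complex.exp (t * (c * ∑ i, z.1 i * z.2 i : ℝ) * Complex.I)
  have hF : Measurable F := by fun_prop
  have hFn : ∀ z, ‖F z‖ ≤ 1 := fun z => by
    have : F z = Complex.exp ((t * (c * ∑ i, z.1 i * z.2 i) : ℝ) * Complex.I) := by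
      simp [F]
    rw [this, Complex.norm_exp_ofReal_mul_I]
  have hFi : Integrable F ((P.map X).prod (P.map a) |>.map Prod.swap) :=
    Integrable.of_bound hF.aestronglyMeasurable 1 (.of_forall hFn)
  rw [Measure.prod_swap] at hFi
  have h1 : charFun (P.map fun ω => c * ∑ i, a ω i * X ω i) t =
      ∫ z, F z ∂((P.map a).prod (P.map X)) := by
    rw [charFun_apply_real, integral_map (by fun_prop) (by fun_prop), ← hjoint,
      integral_map (by fun_prop) hF.aestronglyMeasurable]
  rw [h1, integral_prod_symm _ hFi, integral_map hXm, ← integral_complex_ofReal]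
  · refine integral_congr_ae (.of_forall fun ω => ?_)
    -- With `X` frozen, the inner Fubini integral is the characteristic function of `a` at the
    -- vector t c X.
    have h2 : ∫ v, F (v, X ω) ∂(P.map a) = charFun (P.map a) (WithLp.toLp 2 ((t * c) • X ω)) := by
      rw [charFun_apply]
      refine integral_congr_ae (.of_forall fun v => ?_)
      simp only [F, PiLp.inner_apply]
      simp [Finset.mul_sum]
      congr 2
      refine Finset.sum_congr rfl fun i _ => by ring
    simp only [h2]
    rw [ha.map_eq, charFun_multivariateGaussian (posSemidef_sq_smul_one n σ)]
    simp [Matrix.smul_mulVec, dotProduct]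
    congr 1
    simp only [Finset.mul_sum, Finset.sum_div]
    exact congrArg Neg.neg (Finset.sum_congr rfl fun i _ => by ring)
  · exact hF.stronglyMeasurable.integral_prod_left'.aestronglyMeasurable

end Products

/-- Transfers the L¹ concentration of ∑ X_i² to the characteristic functions. -/
lemma abs_exp_neg_sub_exp_neg_le {u v : ℝ} (hu : 0 ≤ u) (hv : 0 ≤ v) :
    |Real.exp (-u) - Real.exp (-v)| ≤ |u - v| := by
  wlog h : u ≤ v generalizing u v
  · rw [abs_sub_comm, abs_sub_comm u]
    exact this hv hu (le_of_not_ge h)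
  have h1 : Real.exp (-v) ≤ Real.exp (-u) := Real.exp_le_exp.2 (by linarith)
  rw [abs_of_nonneg (by linarith), abs_of_nonpos (by linarith)]
  have h2 : Real.exp (-v) = Real.exp (-u) * Real.exp (-(v - u)) := by
    rw [← Real.exp_add]; ring_nf
  have h3 : Real.exp (-u) ≤ 1 := Real.exp_le_one_iff.2 (by linarith)
  have h4 : 1 - Real.exp (-(v - u)) ≤ v - u := by linarith [Real.add_one_le_exp (-(v - u))]
  have h5 : 0 ≤ 1 - Real.exp (-(v - u)) := by
    linarith [Real.exp_le_one_iff.2 (show -(v - u) ≤ 0 by linarith)]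
  nlinarith [Real.exp_pos (-u)]

/-! ### Quantitative normal approximation and two-sided bounds on the Lyapunov ratio. -/

section Products

variable {n : ℕ} {Ω : Type*} [MeasurableSpace Ω] {P : Measure Ω}
  {σ ε : ℝ} {x : Fin n → ℝ} {a : Ω → EuclideanSpace ℝ (Fin n)} {X : Ω → Fin n → ℝ}

lemma sumStd_sq_eq [IsProbabilityMeasure P] (hε : 0 < ε)
    (ha : HasLaw a (multivariateGaussian 0 (σ ^ 2 • (1 : Matrix (Fin n) (Fin n) ℝ))) P)
    (hX : pdf.IsUniform X (Set.Icc (fun i => x i - ε) (fun i => x i + ε)) P volume)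
    (hind : IndepFun a X P) :
    sumStd P a X ^ 2 = σ ^ 2 * ∑ i, (x i ^ 2 + ε ^ 2 / 3) := by
  rw [sumStd_eq hε ha hX hind, Real.sq_sqrt]
  exact mul_nonneg (sq_nonneg _) (Finset.sum_nonneg fun i _ => by positivity)

lemma mul_le_sum_sq_add (x : Fin n → ℝ) (ε : ℝ) :
    n * (ε ^ 2 / 3) ≤ ∑ i, (x i ^ 2 + ε ^ 2 / 3) := by
  rw [Finset.sum_add_distrib]
  have : 0 ≤ ∑ i, x i ^ 2 := Finset.sum_nonneg fun i _ => sq_nonneg _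
  simpa using this

lemma sumStd_pos [IsProbabilityMeasure P] (hσ : 0 < σ) (hε : 0 < ε)
    (ha : HasLaw a (multivariateGaussian 0 (σ ^ 2 • (1 : Matrix (Fin n) (Fin n) ℝ))) P)
    (hX : pdf.IsUniform X (Set.Icc (fun i => x i - ε) (fun i => x i + ε)) P volume)
    (hind : IndepFun a X P) (hn : 1 ≤ n) : 0 < sumStd P a X := by
  rw [sumStd_eq hε ha hX hind, Real.sqrt_pos]
  have hn' : (0 : ℝ) < n := by exact_mod_cast hn
  have := (mul_pos hn' (by positivity : 0 < ε ^ 2 / 3)).trans_le (mul_le_sum_sq_add x ε)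
  positivity

lemma norm_charFun_standardized_sub_le [IsProbabilityMeasure P] (hσ : 0 < σ) (hε : 0 < ε)
    (ha : HasLaw a (multivariateGaussian 0 (σ ^ 2 • (1 : Matrix (Fin n) (Fin n) ℝ))) P)
    (hX : pdf.IsUniform X (Set.Icc (fun i => x i - ε) (fun i => x i + ε)) P volume)
    (hind : IndepFun a X P) (hn : 1 ≤ n) (t : ℝ) :
    ‖charFun (P.map fun ω => (1 / sumStd P a X) * ∑ i, centeredProduct P a X i ω) t -
      charFun (gaussianReal 0 1) t‖ ≤ t ^ 2 / 2 * √(24 / n) := by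
  have hn' : (0 : ℝ) < n := by exact_mod_cast hn
  have hs := sumStd_sq_eq hε ha hX hind
  have hsp := sumStd_pos hσ hε ha hX hind hn
  have hL1 := sq_integral_abs_sum_sq_sub_le_of_isUniform_box hε hX
  have hSn := mul_le_sum_sq_add x ε
  have hXi := aemeasurable_apply_of_isUniform_box hε hX
  have hQi : Integrable (fun ω => ∑ i, X ω i ^ 2) P := integrable_finsetSum _ fun i _ =>
    (memLp_sq_apply_of_isUniform_box hε hX i).integrable one_le_two
  rw [centeredProduct_eq hε ha hX hind, charFun_map_sum_mul_of_isotropic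
    (aemeasurable_of_isUniform_box hε hX) ha hind]
  set s := sumStd P a X
  set S := ∑ i, (x i ^ 2 + ε ^ 2 / 3)
  have hS : 0 < S := (mul_pos hn' (by positivity)).trans_le hSn
  -- σ cancels because s² = σ² S.
  have hc : (t * (1 / s)) ^ 2 * σ ^ 2 / 2 = t ^ 2 / (2 * S) := by
    rw [mul_pow, div_pow, hs]; field_simp
  have hg : charFun (gaussianReal 0 1) t = ((Real.exp (-(t ^ 2 / (2 * S) * S)) : ℝ) : ℂ) := by
    rw [charFun_gaussianReal, Complex.ofReal_exp]
    congr 1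
    rw [show t ^ 2 / (2 * S) * S = t ^ 2 / 2 by field_simp]
    push_cast
    simp
  rw [hc, hg, ← Complex.ofReal_sub, Complex.norm_real, Real.norm_eq_abs]
  have hei : Integrable (fun ω => Real.exp (-(t ^ 2 / (2 * S) * ∑ i, X ω i ^ 2))) P := by
    refine Integrable.of_bound (AEMeasurable.aestronglyMeasurable (by fun_prop)) 1
      (.of_forall fun ω => ?_)
    rw [Real.norm_eq_abs, Real.abs_exp, Real.exp_le_one_iff, neg_nonpos]
    exact mul_nonneg (by positivity) (Finset.sum_nonneg fun i _ => sq_nonneg _)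
  have hsub : ∫ ω, Real.exp (-(t ^ 2 / (2 * S) * ∑ i, X ω i ^ 2)) ∂P -
      Real.exp (-(t ^ 2 / (2 * S) * S)) = ∫ ω, (Real.exp (-(t ^ 2 / (2 * S) * ∑ i, X ω i ^ 2)) -
        Real.exp (-(t ^ 2 / (2 * S) * S))) ∂P := by
    rw [integral_sub hei (integrable_const _)]
    simp
  rw [hsub]
  clear hsub
  -- The constant 24 = 8 · 3 comes from 8ε² S together with ε² ≤ 3S/n.
  have hsq : ∫ ω, |∑ i, X ω i ^ 2 - S| ∂P ≤ S * √(24 / n) := by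
    refine (pow_le_pow_iff_left₀ (integral_nonneg fun ω => abs_nonneg _) (by positivity) two_ne_zero).1 ?_
    rw [mul_pow, Real.sq_sqrt (by positivity)]
    refine hL1.trans ?_
    rw [← mul_div_assoc, le_div_iff₀ hn']
    nlinarith
  calc |∫ ω, Real.exp (-(t ^ 2 / (2 * S) * ∑ i, X ω i ^ 2)) -
          Real.exp (-(t ^ 2 / (2 * S) * S)) ∂P|
      ≤ ∫ ω, |Real.exp (-(t ^ 2 / (2 * S) * ∑ i, X ω i ^ 2)) -
          Real.exp (-(t ^ 2 / (2 * S) * S))| ∂P := abs_integral_le_integral_abs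
    _ ≤ ∫ ω, t ^ 2 / (2 * S) * |∑ i, X ω i ^ 2 - S| ∂P := by
        refine integral_mono (hei.sub (integrable_const _)).abs
          ((hQi.sub (integrable_const _)).abs.const_mul _) fun ω => ?_
        refine (abs_exp_neg_sub_exp_neg_le (mul_nonneg (by positivity)
          (Finset.sum_nonneg fun i _ => sq_nonneg _)) (by positivity)).trans_eq ?_
        rw [← mul_sub, abs_mul, abs_of_nonneg (by positivity : 0 ≤ t ^ 2 / (2 * S))]
    _ = t ^ 2 / (2 * S) * ∫ ω, |∑ i, X ω i ^ 2 - S| ∂P := integral_const_mul _ _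
    _ ≤ t ^ 2 / (2 * S) * (S * √(24 / n)) := by gcongr
    _ = t ^ 2 / 2 * √(24 / n) := by field_simp

/-- The quantity in Lyapunov's condition of order `δ`, for a single row. -/
noncomputable def lyapunovRatio {n : ℕ} {Ω : Type*} [MeasurableSpace Ω] (P : Measure Ω)
    (a : Ω → EuclideanSpace ℝ (Fin n)) (X : Ω → Fin n → ℝ) (δ : ℝ) : ℝ :=
  (1 / sumStd P a X ^ (2 + δ)) * ∑ i, ∫ ω, |centeredProduct P a X i ω| ^ (2 + δ) ∂P

lemma lyapunovRatio_eq (hε : 0 < ε)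
    (ha : HasLaw a (multivariateGaussian 0 (σ ^ 2 • (1 : Matrix (Fin n) (Fin n) ℝ))) P)
    (hX : pdf.IsUniform X (Set.Icc (fun i => x i - ε) (fun i => x i + ε)) P volume)
    (hind : IndepFun a X P) (δ : ℝ) :
    lyapunovRatio P a X δ = gaussianAbsMoment σ (2 + δ) *
      ((∑ i, ∫ ω, |X ω i| ^ (2 + δ) ∂P) / sumStd P a X ^ (2 + δ)) := by
  rw [lyapunovRatio, centeredProduct_eq hε ha hX hind]
  simp_rw [integral_abs_rpow_mul_of_isotropic hε ha hX hind, ← Finset.mul_sum]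
  ring

/-- Only the coordinate attaining ‖x‖ is kept in the sum of moments; Jensen bounds its term below.
-/
lemma mul_rpow_norm_div_le_lyapunovRatio [IsProbabilityMeasure P] (hσ : 0 < σ) (hε : 0 < ε)
    (ha : HasLaw a (multivariateGaussian 0 (σ ^ 2 • (1 : Matrix (Fin n) (Fin n) ℝ))) P)
    (hX : pdf.IsUniform X (Set.Icc (fun i => x i - ε) (fun i => x i + ε)) P volume)
    (hind : IndepFun a X P) (hn : 1 ≤ n) {δ : ℝ} (hδ : 0 < δ) :
    gaussianAbsMoment σ (2 + δ) * (‖x‖ / sumStd P a X) ^ (2 + δ) ≤ lyapunovRatio P a X δ := by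
  have hsp := sumStd_pos hσ hε ha hX hind hn
  have : NeZero n := ⟨by omega⟩
  rw [lyapunovRatio_eq hε ha hX hind, Real.div_rpow (norm_nonneg _) hsp.le]
  refine mul_le_mul_of_nonneg_left ?_ (gaussianAbsMoment_pos hσ (by linarith)).le
  gcongr
  obtain ⟨i, hi⟩ : ∃ i, ‖x‖ = |x i| := by
    obtain ⟨i, -, hi⟩ := Finset.exists_max_image Finset.univ (fun i => ‖x i‖)
      Finset.univ_nonempty
    exact ⟨i, le_antisymm ((pi_norm_le_iff_of_nonneg (abs_nonneg _)).2 fun j =>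
      hi j (Finset.mem_univ j)) (norm_le_pi_norm x i)⟩
  rw [hi]
  exact (abs_rpow_le_integral_of_isUniform_box hε hX i (by linarith)).trans
    (Finset.single_le_sum (f := fun i => ∫ ω, |X ω i| ^ (2 + δ) ∂P)
      (fun j _ => integral_nonneg fun ω => by positivity) (Finset.mem_univ i))

lemma lyapunovRatio_le [IsProbabilityMeasure P] (hσ : 0 < σ) (hε : 0 < ε)
    (ha : HasLaw a (multivariateGaussian 0 (σ ^ 2 • (1 : Matrix (Fin n) (Fin n) ℝ))) P)
    (hX : pdf.IsUniform X (Set.Icc (fun i => x i - ε) (fun i => x i + ε)) P volume)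
    (hind : IndepFun a X P) (hn : 1 ≤ n) {δ : ℝ} (hδ : 0 < δ) :
    lyapunovRatio P a X δ ≤ gaussianAbsMoment σ (2 + δ) / σ ^ 2 *
      (‖x‖ / sumStd P a X + ε / sumStd P a X) ^ δ := by
  have hsp := sumStd_pos hσ hε ha hX hind hn
  have hK := gaussianAbsMoment_pos hσ (p := 2 + δ) (by linarith)
  have hs := sumStd_sq_eq hε ha hX hind
  have hsum : ∑ i, ∫ ω, |X ω i| ^ (2 + δ) ∂P ≤
      (‖x‖ + ε) ^ δ * ∑ i, (x i ^ 2 + ε ^ 2 / 3) := by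
    rw [Finset.mul_sum]
    exact Finset.sum_le_sum fun i _ => integral_abs_rpow_le_of_isUniform_box hε hX i hδ.le
  rw [lyapunovRatio_eq hε ha hX hind, ← add_div, Real.div_rpow (by positivity) hsp.le,
    Real.rpow_add hsp, Real.rpow_two, div_mul_eq_mul_div, mul_div_assoc]
  refine mul_le_mul_of_nonneg_left ?_ hK.le
  rw [div_le_iff₀ (by positivity), hs]
  refine hsum.trans_eq ?_
  have := Real.rpow_pos_of_pos hsp δ
  generalize ∑ i, (x i ^ 2 + ε ^ 2 / 3) = S
  field_simp

/-- The noise alone contributes s_n² ≥ σ² n ε²/3, so ε/s_n vanishes for any centres. -/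
lemma div_sumStd_le [IsProbabilityMeasure P] (hσ : 0 < σ) (hε : 0 < ε)
    (ha : HasLaw a (multivariateGaussian 0 (σ ^ 2 • (1 : Matrix (Fin n) (Fin n) ℝ))) P)
    (hX : pdf.IsUniform X (Set.Icc (fun i => x i - ε) (fun i => x i + ε)) P volume)
    (hind : IndepFun a X P) (hn : 1 ≤ n) :
    ε / sumStd P a X ≤ √(3 / σ ^ 2 / n) := by
  have hn' : (0 : ℝ) < n := by exact_mod_cast hn
  have hsp := sumStd_pos hσ hε ha hX hind hn
  have hs := sumStd_sq_eq hε ha hX hind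
  refine Real.le_sqrt_of_sq_le ?_
  have hSn := mul_le_mul_of_nonneg_left (mul_le_sum_sq_add x ε) (sq_nonneg σ)
  rw [div_pow, div_le_iff₀ (by positivity), hs]
  calc ε ^ 2 = 3 / σ ^ 2 / n * (σ ^ 2 * (n * (ε ^ 2 / 3))) := by field_simp
    _ ≤ _ := by gcongr

end Products

/-! ### Passage to the limit. -/

lemma tendsto_sqrt_const_div_atTop (C : ℝ) :
    Tendsto (fun n : ℕ => √(C / n)) atTop (𝓝 0) := by
  simpa using (tendsto_const_div_atTop_nhds_zero_nat C).sqrt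

-- In the last conjunct, `‖x n‖` is the norm of `Fin n → ℝ`, that is, `max_i |x_i|`.
theorem proposition1 {Ω : ℕ → Type*} [∀ n, MeasurableSpace (Ω n)]
    (P : ∀ n, Measure (Ω n)) [∀ n, IsProbabilityMeasure (P n)]
    (σ ε : ℝ) (hσ : 0 < σ) (hε : 0 < ε)
    (x : ∀ n : ℕ, Fin n → ℝ)
    (a : ∀ n, Ω n → EuclideanSpace ℝ (Fin n))
    (xt : ∀ n, Ω n → Fin n → ℝ)
    (ha : ∀ n, HasLaw (a n)
      (multivariateGaussian 0 (σ ^ 2 • (1 : Matrix (Fin n) (Fin n) ℝ))) (P n))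
    (hxt : ∀ n, pdf.IsUniform (xt n)
      (Set.Icc (fun i => x n i - ε) (fun i => x n i + ε)) (P n) volume)
    (hind : ∀ n, IndepFun (a n) (xt n) (P n)) :
    -- all moments of the products are finite, so that the expectations and the variance exist
    (∀ (n : ℕ) (i : Fin n) (p : NNReal), MemLp (fun ω => a n ω i * xt n ω i) p (P n)) ∧
    -- the normalization is by a positive number
    (∀ n : ℕ, 1 ≤ n → 0 < sumStd (P n) (a n) (xt n)) ∧
    -- convergence in distribution to the standard normal law
    TendstoInDistribution
      (fun (n : ℕ) (ω : Ω n) => (1 / sumStd (P n) (a n) (xt n)) *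
        ∑ i, centeredProduct (P n) (a n) (xt n) i ω)
      atTop (id : ℝ → ℝ) P (gaussianReal 0 1) ∧
    -- Lyapunov's condition, exactly when no entry of the centre dominates
    (∀ δ : ℝ, 0 < δ →
      (LyapunovCondition P a xt δ ↔
        Tendsto (fun n : ℕ => ‖x n‖ / sumStd (P n) (a n) (xt n)) atTop (𝓝 0))) := by
  have hsum : ∀ n, AEMeasurable (fun ω => (1 / sumStd (P n) (a n) (xt n)) *
      ∑ i, centeredProduct (P n) (a n) (xt n) i ω) (P n) := fun n => by
    rw [centeredProduct_eq hε (ha n) (hxt n) (hind n)]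
    have h1 := fun i => (hasLaw_apply_of_isotropic (ha n) i).aemeasurable
    have h2 := aemeasurable_apply_of_isUniform_box hε (hxt n)
    fun_prop
  refine ⟨fun n i p => memLp_mul_of_isotropic_of_isUniform_box hε (ha n) (hxt n) i p,
    fun n hn => sumStd_pos hσ hε (ha n) (hxt n) (hind n) hn, ⟨hsum, by fun_prop, ?_⟩,
    fun δ hδ => ?_⟩
  · refine ProbabilityMeasure.tendsto_iff_tendsto_charFun.2 fun t => ?_
    simp only [ProbabilityMeasure.coe_mk, Measure.map_id]
    have hlim := (tendsto_sqrt_const_div_atTop 24).const_mul (t ^ 2 / 2)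
    rw [mul_zero] at hlim
    refine tendsto_iff_norm_sub_tendsto_zero.2
      (squeeze_zero' (.of_forall fun _ => norm_nonneg _) ?_ hlim)
    -- At n = 0 the normalization is by s_0 = 0, so the bounds hold only eventually.
    filter_upwards [eventually_ge_atTop 1] with n hn
    exact norm_charFun_standardized_sub_le hσ hε (ha n) (hxt n) (hind n) hn t
  · change Tendsto (fun n => lyapunovRatio (P n) (a n) (xt n) δ) atTop (𝓝 0) ↔ _
    have hK := gaussianAbsMoment_pos hσ (p := 2 + δ) (by linarith)
    have hδ' : 2 + δ ≠ 0 := by linarith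
    have hs0 : ∀ n, 0 ≤ sumStd (P n) (a n) (xt n) := fun n => Real.sqrt_nonneg _
    have hx0 : ∀ n, 0 ≤ ‖x n‖ / sumStd (P n) (a n) (xt n) := fun n =>
      div_nonneg (norm_nonneg _) (hs0 n)
    constructor
    · intro h
      have h1 : Tendsto (fun n => (‖x n‖ / sumStd (P n) (a n) (xt n)) ^ (2 + δ)) atTop (𝓝 0) := by
        refine squeeze_zero' (.of_forall fun n => Real.rpow_nonneg (hx0 n) _) ?_
          (by simpa using h.div_const (gaussianAbsMoment σ (2 + δ)))
        filter_upwards [eventually_ge_atTop 1] with n hn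
        rw [le_div_iff₀' hK]
        exact mul_rpow_norm_div_le_lyapunovRatio hσ hε (ha n) (hxt n) (hind n) hn hδ
      -- The root of order 2 + δ is continuous at 0, which recovers the ratio itself.
      have h2 := h1.rpow_const (p := (2 + δ)⁻¹) (Or.inr (by positivity))
      rw [Real.zero_rpow (inv_ne_zero hδ')] at h2
      exact h2.congr fun n => Real.rpow_rpow_inv (hx0 n) hδ'
    · intro h
      have hεs : Tendsto (fun n => ε / sumStd (P n) (a n) (xt n)) atTop (𝓝 0) := by
        refine squeeze_zero' (.of_forall fun n => div_nonneg hε.le (hs0 n)) ?_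
          (tendsto_sqrt_const_div_atTop (3 / σ ^ 2))
        filter_upwards [eventually_ge_atTop 1] with n hn
        exact div_sumStd_le hσ hε (ha n) (hxt n) (hind n) hn
      have h1 := ((h.add hεs).rpow_const (p := δ) (Or.inr hδ.le)).const_mul
        (gaussianAbsMoment σ (2 + δ) / σ ^ 2)
      rw [add_zero, Real.zero_rpow hδ.ne', mul_zero] at h1
      refine squeeze_zero' (.of_forall fun n => ?_) ?_ h1
      · exact mul_nonneg (one_div_nonneg.2 (Real.rpow_nonneg (hs0 n) _))
          (Finset.sum_nonneg fun i _ => integral_nonneg fun ω => by positivity)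
      · filter_upwards [eventually_ge_atTop 1] with n hn
        exact lyapunovRatio_le hσ hε (ha n) (hxt n) (hind n) hn hδ
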